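/- **Setting.** Consider a hidden Markov model with $S$ hidden states, initial distribution $\pi$, transition matrix $\mathbf T_{ij}=\mathrm P(h_{t+1}=j\mid h_t=i)$ and emission distributions $\mathcal F_1,\dots,\mathcal F_S$ on $\mathbb R^p$; let $U\in\mathbb R^{p\times d}$ be a fixed matrix, and let $(Y_1,Y_2,Y_3)$ denote the projections $Y_j=U^\top X_j$ of the first three observations $X_1,X_2,X_3$ of the model. Put $$\mu=\mathrm E\,Y_1,\qquad \Sigma=\mathrm E(Y_2\otimes Y_1)=\mathrm E(Y_2Y_1^\top),\qquad K=\mathrm E(Y_3\otimes Y_1\otimes Y_2),\qquad K(a)_{ij}=\sum_k K_{ijk}a_k .$$ Assume that $\Sigma$ is invertible and that all entries of $Y_1$, $Y_2\otimes Y_1$ and $Y_3\otimes Y_1\otimes Y_2$ have finite second moments. Fix $T$ and (non-random) $x_1,\dots,x_T\in\mathbb R^p$, let $y_t=U^\top x_t$, and write the likelihood in its spectral form $$\Pr(x_{1:T})=c_\infty^\top C(y_T)C(y_{T-1})\cdots C(y_1)c_1,\qquad c_1=\mu,\quad c_\infty^\top=\mu^\top\Sigma^{-1},\quad C(y)=K(y)\Sigma^{-1}.$$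 Given i.i.d. triples $(Y_{n,1},Y_{n,2},Y_{n,3})$, $n=1,2,\dots$, distributed as $(Y_1,Y_2,Y_3)$, let $\hat\mu=\frac1N\sum_{n\le N}Y_{n,1}$, $\hat\Sigma=\frac1N\sum_{n\le N}Y_{n,2}\otimes Y_{n,1}$, $\hat K=\frac1N\sum_{n\le N}Y_{n,3}\otimes Y_{n,1}\otimes Y_{n,2}$, and let $\widehat{\Pr}(x_{1:T})$ be the same expression with $\mu,\Sigma,K$ replaced by $\hat\mu,\hat\Sigma,\hat K$ (with any fixed convention, say $\hat\Sigma^{-1}=0$, on the event, of probability tending to $0$, that $\hat\Sigma$ is singular). Define $$v=\bigl(\mu^\top\Sigma^{-1}K(y_T)\Sigma^{-1}\cdots K(y_1)\Sigma^{-1}\bigr)^\top,\qquad \tilde v=\Sigma^{-1}K(y_T)\Sigma^{-1}\cdots K(y_1)\Sigma^{-1}\mu,$$ $$a_t=\bigl(\mu^\top\Sigma^{-1}K(y_T)\Sigma^{-1}\cdots K(y_{t+1})\Sigma^{-1}\bigr)^\top,\qquad \tilde a_t=\Sigma^{-1}K(y_{t-1})\Sigma^{-1}\cdots K(y_1)\Sigma^{-1}\mu\qquad(1\le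 t\le T),$$ $$b_t=\bigl(\mu^\top\Sigma^{-1}K(y_T)\Sigma^{-1}\cdots K(y_{t+1})\Sigma^{-1}\bigr)^\top,\qquad \tilde b_t=\Sigma^{-1}K(y_t)\Sigma^{-1}\cdots K(y_1)\Sigma^{-1}\mu\qquad(0\le t\le T),$$ let $\mathcal F(\cdot)$ flatten a matrix or a 3-way tensor into the vector of its entries, and set $$\beta=\Bigl[(v+\tilde v)^\top;\ -\Bigl(\sum_{t=0}^T\mathcal F(b_t\otimes\tilde b_t)\Bigr)^\top;\ \Bigl(\sum_{t=1}^T\mathcal F(a_t\otimes\tilde a_t\otimes y_t)\Bigr)^\top\Bigr]^\top .$$ **Theorem.** (i) As $N\to\infty$ with $T$ fixed, $$\sqrt N\,\bigl(\widehat{\Pr}(x_{1:T})-\Pr(x_{1:T})\bigr)\ \xrightarrow{\ d\ }\ \mathcal N\!\left(0,\ \beta^\top\,\mathrm{Cov}\!\begin{bmatrix}Y_1\\ \mathcal F(Y_2\otimes Y_1)\\ \mathcal F(Y_3\otimes Y_1\otimes Y_2)\end{bmatrix}\beta\right)$$ (a point mass at $0$ if the variance is $0$). (ii) If moreover $d=S$,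 the observations are symbols of a finite alphabet coded as the standard unit vectors of $\mathbb R^p$ (so every $\mathcal F_s$ is carried by these vectors, and $x_1,\dots,x_T$ are among them), and $UU^\top M=M$ for the matrix $M=[M_1,\dots,M_S]$ of emission means, then $\Pr(x_{1:T})$ is the probability that the first $T$ observations of the model are $x_1,\dots,x_T$. -/

import Mathlib

open MeasureTheory ProbabilityTheory Filter
open scoped Matrix NNReal

noncomputable section

/-! ### Hidden Markov models -/

/-- A hidden Markov model with `S` hidden states and observations in `ℝ^p`: an initial
distribution, a transition matrix `trans i j = P(h_{t+1} = j | h_t = i)`, and for each hidden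
state an emission distribution on `ℝ^p`. -/
structure HMM (S p : ℕ) where
  init : Fin S → ℝ
  init_nonneg : ∀ s, 0 ≤ init s
  init_sum : ∑ s, init s = 1
  trans : Matrix (Fin S) (Fin S) ℝ
  trans_nonneg : ∀ s s', 0 ≤ trans s s'
  trans_sum : ∀ s, ∑ s', trans s s' = 1
  emission : Fin S → Measure (Fin p → ℝ)
  emission_prob : ∀ s, IsProbabilityMeasure (emission s)

namespace HMM

variable {S p : ℕ}

/-- Probability that the first `n` hidden states are `h 0, …, h (n-1)`. -/
def pathProb (H : HMM S p) : (n : ℕ) → (Fin n → Fin S) → ℝ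
  | 0, _ => 1
  | n + 1, h => H.init (h 0) * ∏ t : Fin n, H.trans (h t.castSucc) (h t.succ)

/-- Joint law of the first `n` observations: given the hidden path, the observations are
independent, each with the emission distribution of its hidden state. -/
def obsLaw (H : HMM S p) (n : ℕ) : Measure (Fin n → Fin p → ℝ) :=
  ∑ h : Fin n → Fin S,
    ENNReal.ofReal (H.pathProb n h) • Measure.pi (fun t => H.emission (h t))

/-- The matrix `M` whose column `s` is the mean of the emission distribution of state `s`. -/
def meanMatrix (H : HMM S p) : Matrix (Fin p) (Fin S) ℝ :=
  Matrix.of fun o s => ∫ z, z o ∂(H.emission s)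

/-- Law of the triple `(Y₁, Y₂, Y₃)` with `Y_j = Uᵀ X_j` and `(X₁, X₂, X₃)` the first three
observations of the model.  Index `j : Fin 3` stands for time `j + 1`. -/
def tripleLaw {d : ℕ} (H : HMM S p) (U : Matrix (Fin p) (Fin d) ℝ) :
    Measure (Fin 3 → Fin d → ℝ) :=
  (H.obsLaw 3).map fun X j => Uᵀ *ᵥ X j

end HMM

/-! ### First, second and third moments, and the spectral likelihood -/

/-- A vector `μ ∈ ℝ^d`, a matrix `Σ ∈ ℝ^{d×d}` and a 3-way tensor `K ∈ ℝ^{d×d×d}`. -/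
structure Moments (d : ℕ) where
  mu : Fin d → ℝ
  Sig : Matrix (Fin d) (Fin d) ℝ
  K : Fin d → Fin d → Fin d → ℝ

/-- Population moments `μ = E Y₁`, `Σ = E (Y₂ ⊗ Y₁)`, `K = E (Y₃ ⊗ Y₁ ⊗ Y₂)` when
`(Y₁, Y₂, Y₃)` has law `Q`. -/
def popMoments {d : ℕ} (Q : Measure (Fin 3 → Fin d → ℝ)) : Moments d where
  mu i := ∫ y, y 0 i ∂Q
  Sig := Matrix.of fun i j => ∫ y, y 1 i * y 0 j ∂Q
  K i j k := ∫ y, y 2 i * y 0 j * y 1 k ∂Q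

/-- Empirical moments of the first `N` triples of the sequence `y`. -/
def empMoments {d : ℕ} (y : ℕ → Fin 3 → Fin d → ℝ) (N : ℕ) : Moments d where
  mu i := (1 / (N : ℝ)) * ∑ n ∈ Finset.range N, y n 0 i
  Sig := Matrix.of fun i j => (1 / (N : ℝ)) * ∑ n ∈ Finset.range N, y n 1 i * y n 0 j
  K i j k := (1 / (N : ℝ)) * ∑ n ∈ Finset.range N, y n 2 i * y n 0 j * y n 1 k

namespace Moments

variable {d : ℕ}

/-- The matrix `K(a)`, with `K(a)_{ij} = ∑_k K_{ijk} a_k`. -/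
def Kmat (m : Moments d) (a : Fin d → ℝ) : Matrix (Fin d) (Fin d) ℝ :=
  Matrix.of fun i j => ∑ k, m.K i j k * a k

/-- `C(a) = K(a) Σ⁻¹`. -/
def C (m : Moments d) (a : Fin d → ℝ) : Matrix (Fin d) (Fin d) ℝ :=
  m.Kmat a * m.Sig⁻¹

/-- `prodC y s t = C(y_t) C(y_{t-1}) ⋯ C(y_{s+1})`, the identity if `t ≤ s`. -/
def prodC (m : Moments d) (y : ℕ → Fin d → ℝ) (s : ℕ) : ℕ → Matrix (Fin d) (Fin d) ℝ
  | 0 => 1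
  | t + 1 => if s ≤ t then m.C (y (t + 1)) * m.prodC y s t else 1

/-- `c₁ = μ`. -/
def c1 (m : Moments d) : Fin d → ℝ := m.mu

/-- `c_∞ᵀ = μᵀ Σ⁻¹`. -/
def cInf (m : Moments d) : Fin d → ℝ := m.mu ᵥ* m.Sig⁻¹

/-- The spectral likelihood `c_∞ᵀ C(y_T) C(y_{T-1}) ⋯ C(y_1) c₁`. -/
def specLik (m : Moments d) (T : ℕ) (y : ℕ → Fin d → ℝ) : ℝ :=
  m.cInf ⬝ᵥ (m.prodC y 0 T *ᵥ m.c1)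

/-- `vᵀ = μᵀ Σ⁻¹ K(y_T) Σ⁻¹ ⋯ K(y_1) Σ⁻¹`. -/
def v (m : Moments d) (T : ℕ) (y : ℕ → Fin d → ℝ) : Fin d → ℝ :=
  m.mu ᵥ* (m.Sig⁻¹ * m.prodC y 0 T)

/-- `ṽ = Σ⁻¹ K(y_T) Σ⁻¹ ⋯ K(y_1) Σ⁻¹ μ`. -/
def vTilde (m : Moments d) (T : ℕ) (y : ℕ → Fin d → ℝ) : Fin d → ℝ :=
  (m.Sig⁻¹ * m.prodC y 0 T) *ᵥ m.mu

/-- `a_tᵀ = μᵀ Σ⁻¹ K(y_T) Σ⁻¹ ⋯ K(y_{t+1}) Σ⁻¹`, for `1 ≤ t ≤ T`. -/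
def a (m : Moments d) (T : ℕ) (y : ℕ → Fin d → ℝ) (t : ℕ) : Fin d → ℝ :=
  m.mu ᵥ* (m.Sig⁻¹ * m.prodC y t T)

/-- `ã_t = Σ⁻¹ K(y_{t-1}) Σ⁻¹ ⋯ K(y_1) Σ⁻¹ μ`, for `1 ≤ t ≤ T`. -/
def aTilde (m : Moments d) (y : ℕ → Fin d → ℝ) (t : ℕ) : Fin d → ℝ :=
  (m.Sig⁻¹ * m.prodC y 0 (t - 1)) *ᵥ m.mu

/-- `b_tᵀ = μᵀ Σ⁻¹ K(y_T) Σ⁻¹ ⋯ Σ⁻¹ K(y_{t+1}) Σ⁻¹`, for `0 ≤ t ≤ T`. -/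
def b (m : Moments d) (T : ℕ) (y : ℕ → Fin d → ℝ) (t : ℕ) : Fin d → ℝ :=
  m.mu ᵥ* (m.Sig⁻¹ * m.prodC y t T)

/-- `b̃_t = Σ⁻¹ K(y_t) Σ⁻¹ ⋯ K(y_1) Σ⁻¹ μ`, for `0 ≤ t ≤ T`. -/
def bTilde (m : Moments d) (y : ℕ → Fin d → ℝ) (t : ℕ) : Fin d → ℝ :=
  (m.Sig⁻¹ * m.prodC y 0 t) *ᵥ m.mu

end Moments

/-! ### Flattening, the stacked vector and the asymptotic variance -/

/-- `F(u ⊗ w)`, the flattened outer product; a flattened `d × d` matrix is indexed by pairs. -/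
def flat2 {d : ℕ} (u w : Fin d → ℝ) : Fin d × Fin d → ℝ := fun e => u e.1 * w e.2

/-- `F(u ⊗ w ⊗ z)`, the flattened outer product; a flattened 3-way tensor is indexed by
triples. -/
def flat3 {d : ℕ} (u w z : Fin d → ℝ) : Fin d × Fin d × Fin d → ℝ :=
  fun e => u e.1 * w e.2.1 * z e.2.2

/-- Index set of the stacked vectors of length `d + d² + d³`. -/
abbrev StackIdx (d : ℕ) : Type := Fin d ⊕ ((Fin d × Fin d) ⊕ (Fin d × Fin d × Fin d))

/-- The stacked vector `[Y₁; F(Y₂ ⊗ Y₁); F(Y₃ ⊗ Y₁ ⊗ Y₂)]`. -/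
def stack {d : ℕ} (y : Fin 3 → Fin d → ℝ) : StackIdx d → ℝ :=
  Sum.elim (y 0) (Sum.elim (flat2 (y 1) (y 0)) (flat3 (y 2) (y 0) (y 1)))

/-- Covariance matrix of the stacked vector when `(Y₁, Y₂, Y₃)` has law `Q`. -/
def stackCov {d : ℕ} (Q : Measure (Fin 3 → Fin d → ℝ)) :
    Matrix (StackIdx d) (StackIdx d) ℝ :=
  Matrix.of fun e f => cov[fun y => stack y e, fun y => stack y f; Q]

/-- `β = [v + ṽ; -∑_{t=0}^T F(b_t ⊗ b̃_t); ∑_{t=1}^T F(a_t ⊗ ã_t ⊗ y_t)]`. -/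
def betaVec {d : ℕ} (m : Moments d) (T : ℕ) (y : ℕ → Fin d → ℝ) : StackIdx d → ℝ :=
  Sum.elim (m.v T y + m.vTilde T y)
    (Sum.elim (-∑ t ∈ Finset.Icc 0 T, flat2 (m.b T y t) (m.bTilde y t))
      (∑ t ∈ Finset.Icc 1 T, flat3 (m.a T y t) (m.aTilde y t) (y t)))

/-- `βᵀ Cov([Y₁; F(Y₂ ⊗ Y₁); F(Y₃ ⊗ Y₁ ⊗ Y₂)]) β`. -/
def asympVar {d : ℕ} (Q : Measure (Fin 3 → Fin d → ℝ)) (T : ℕ) (y : ℕ → Fin d → ℝ) : ℝ :=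
  betaVec (popMoments Q) T y ⬝ᵥ (stackCov Q *ᵥ betaVec (popMoments Q) T y)

/-- The standard unit vectors of `ℝ^p`, the codes of the `p` symbols of a finite alphabet. -/
def unitVectors (p : ℕ) : Set (Fin p → ℝ) := Set.range fun o => Pi.single o 1

end

/-! Part (i) is the delta method. The empirical moments are the sample mean of the i.i.d. stacked
vectors `stack (Y n)`, and the spectral likelihood is one function of the stacked moments,
differentiable wherever Σ is invertible. A first-order expansion reduces the claim to the scalar
central limit theorem for the derivative applied to the stacked vectors, with a remainder that is
negligible by Chebyshev. It remains to identify the gradient with β: in μᵀΣ⁻¹K(y_T)Σ⁻¹⋯K(y_1)Σ⁻¹μ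
the product rule differentiates one factor at a time. The two copies of μ give v + ṽ, the T+1 copies
of Σ⁻¹ give the terms b_t ⊗ b̃_t with a minus sign from d(Σ⁻¹) = -Σ⁻¹ dΣ Σ⁻¹, and the T copies of K
give a_t ⊗ ã_t ⊗ y_t (`hasFDerivAt_specLik_ofStack`).

Part (ii) is a change of basis. With A = UᵀM and B = 𝐓ᵀ diag(π) Aᵀ, conditional independence gives μ
= Aπ, Σ = AB and K(a) = A 𝐓ᵀ diag(Aᵀa) B. For d = S, A and B are invertible, so C(a) = A 𝐓ᵀ
diag(Aᵀa) A⁻¹: the spectral product is the forward algorithm conjugated by A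
(`specLik_eq_sum_forward`). The condition UUᵀM = M turns its weights into emission probabilities. -/

noncomputable section

/-! ### The delta method for sample means -/

section DeltaMethod

variable {ι Ω : Type*} [Fintype ι] [MeasurableSpace Ω]

/-- Chebyshev's inequality for the sup-norm deviation of the mean of i.i.d. vectors. -/
lemma measureReal_norm_mean_sub_ge_le (P : Measure Ω) [IsProbabilityMeasure P]
    (Z : ℕ → Ω → ι → ℝ) (hL2 : ∀ n e, MemLp (fun ω => Z n ω e) 2 P)
    (hindep : iIndepFun Z P)
    (hident : ∀ n, IdentDistrib (Z n) (Z 0) P P) (m : ι → ℝ) (hm : ∀ e, m e = ∫ ω, Z 0 ω e ∂P)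
    {N : ℕ} (hN : N ≠ 0) {r : ℝ} (hr : 0 < r) :
    P.real {ω | r ≤ ‖(fun e => (1 / (N : ℝ)) * ∑ n ∈ Finset.range N, Z n ω e) - m‖} ≤
      (∑ e, Var[fun ω => Z 0 ω e; P]) / (N * r ^ 2) := by
  have hN' : (0 : ℝ) < N := by positivity
  have hid : ∀ n e, IdentDistrib (fun ω => Z n ω e) (fun ω => Z 0 ω e) P P := fun n e =>
    (hident n).comp (u := fun z : ι → ℝ => z e) (measurable_pi_apply e)
  have hcoord : ∀ e, P.real {ω | r ≤ |(1 / (N : ℝ)) * ∑ n ∈ Finset.range N, Z n ω e - m e|} ≤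
      Var[fun ω => Z 0 ω e; P] / (N * r ^ 2) := by
    intro e
    have hmem : MemLp (fun ω => (1 / (N : ℝ)) * ∑ n ∈ Finset.range N, Z n ω e) 2 P :=
      (memLp_finsetSum _ fun n _ => hL2 n e).const_mul _
    have hmean : ∫ ω, (1 / (N : ℝ)) * ∑ n ∈ Finset.range N, Z n ω e ∂P = m e := by
      rw [integral_const_mul, integral_finsetSum _ fun n _ => (hL2 n e).integrable (by norm_num),
        Finset.sum_congr rfl fun n _ => (hid n e).integral_eq, ← hm]
      simp [hN]
    have hvar : Var[fun ω => (1 / (N : ℝ)) * ∑ n ∈ Finset.range N, Z n ω e; P] =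
        Var[fun ω => Z 0 ω e; P] / N := by
      have hs := IndepFun.variance_sum (μ := P) (X := fun n ω => Z n ω e) (s := Finset.range N)
        (fun n _ => hL2 n e) (fun i _ j _ hij =>
          (hindep.indepFun hij).comp (φ := fun z : ι → ℝ => z e) (ψ := fun z : ι → ℝ => z e)
            (measurable_pi_apply e) (measurable_pi_apply e))
      rw [Finset.sum_congr rfl fun n _ => (hid n e).variance_eq] at hs
      have hfun : (∑ n ∈ Finset.range N, fun ω => Z n ω e) =
          fun ω => ∑ n ∈ Finset.range N, Z n ω e := by
        ext ω; simp
      rw [hfun] at hs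
      rw [variance_const_mul, hs]
      simp only [Finset.sum_const, Finset.card_range, nsmul_eq_mul]
      field_simp
    have h := meas_ge_le_variance_div_sq hmem hr
    rw [hmean, hvar] at h
    have h0 : 0 ≤ Var[fun ω => Z 0 ω e; P] / N / r ^ 2 :=
      div_nonneg (div_nonneg (variance_nonneg _ _) hN'.le) (by positivity)
    calc _ ≤ (ENNReal.ofReal (Var[fun ω => Z 0 ω e; P] / N / r ^ 2)).toReal :=
          ENNReal.toReal_mono ENNReal.ofReal_ne_top h
      _ = _ := by rw [ENNReal.toReal_ofReal h0, div_div]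
  rw [Finset.sum_div]
  calc _ ≤ P.real (⋃ e, {ω | r ≤ |(1 / (N : ℝ)) * ∑ n ∈ Finset.range N, Z n ω e - m e|}) := by
        refine measureReal_mono fun ω hω => ?_
        simp only [Set.mem_ofPred_eq] at hω
        simp only [Set.mem_iUnion, Set.mem_ofPred_eq]
        by_contra! hc
        exact absurd hω (not_le.2 ((pi_norm_lt_iff hr).2 fun e => hc e))
    _ ≤ ∑ e, P.real {ω | r ≤ |(1 / (N : ℝ)) * ∑ n ∈ Finset.range N, Z n ω e - m e|} :=
        measureReal_iUnion_fintype_le _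
    _ ≤ _ := Finset.sum_le_sum fun e _ => hcoord e

/-- The linearization error of a function of the sample mean is `o(1/√N)` in probability. -/
lemma tendstoInMeasure_sqrt_mul_mean_remainder (P : Measure Ω) [IsProbabilityMeasure P]
    (Z : ℕ → Ω → ι → ℝ) (hL2 : ∀ n e, MemLp (fun ω => Z n ω e) 2 P)
    (hindep : iIndepFun Z P)
    (hident : ∀ n, IdentDistrib (Z n) (Z 0) P P) (m : ι → ℝ) (hm : ∀ e, m e = ∫ ω, Z 0 ω e ∂P)
    (f : (ι → ℝ) → ℝ) (D : (ι → ℝ) →L[ℝ] ℝ) (hD : HasFDerivAt f D m) :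
    TendstoInMeasure P (fun (N : ℕ) ω => √(N : ℝ) *
      (f (fun e => (1 / (N : ℝ)) * ∑ n ∈ Finset.range N, Z n ω e) - f m -
        D ((fun e => (1 / (N : ℝ)) * ∑ n ∈ Finset.range N, Z n ω e) - m))) atTop 0 := by
  set V : ℝ := ∑ e, Var[fun ω => Z 0 ω e; P]
  have hV : 0 ≤ V := Finset.sum_nonneg fun e _ => variance_nonneg _ _
  rw [tendstoInMeasure_iff_measureReal_norm]
  intro ε hε
  rw [Metric.tendsto_atTop]
  intro η hη
  -- At radius ε/(√N c) Chebyshev gives Vc²/ε², independent of N. So the slope c is fixed first;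
  -- differentiability then gives δ, and only the event of leaving the δ-ball needs N large.
  obtain ⟨c, hc, hcV⟩ : ∃ c : ℝ, 0 < c ∧ V * c ^ 2 / ε ^ 2 < η / 2 := by
    have : Tendsto (fun c : ℝ => V * c ^ 2 / ε ^ 2) (nhdsWithin 0 (Set.Ioi 0)) (nhds 0) := by
      have h : Continuous fun c : ℝ => V * c ^ 2 / ε ^ 2 := by fun_prop
      simpa using (h.tendsto 0).mono_left nhdsWithin_le_nhds
    obtain ⟨c, h1, h2⟩ := ((this.eventually_lt_const (half_pos hη)).and
      self_mem_nhdsWithin).exists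
    exact ⟨c, h2, h1⟩
  obtain ⟨δ, hδ, hball⟩ := Metric.eventually_nhds_iff.1 (hD.isLittleO.def hc)
  obtain ⟨N₀, hN₀⟩ := exists_nat_gt (V / δ ^ 2 / (η / 2))
  refine ⟨N₀ + 1, fun N hN => ?_⟩
  have hN0 : N ≠ 0 := by omega
  have hNpos : (0 : ℝ) < N := by positivity
  have hsq : 0 < √(N : ℝ) := Real.sqrt_pos.2 hNpos
  set W : Ω → ι → ℝ := fun ω => (fun e => (1 / (N : ℝ)) * ∑ n ∈ Finset.range N, Z n ω e) - m
  have hr : 0 < ε / (√(N : ℝ) * c) := by positivity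
  have hb1 := measureReal_norm_mean_sub_ge_le P Z hL2 hindep hident m hm hN0 hδ
  have hb2 := measureReal_norm_mean_sub_ge_le P Z hL2 hindep hident m hm hN0 hr
  have e2 : (N : ℝ) * (ε / (√(N : ℝ) * c)) ^ 2 = ε ^ 2 / c ^ 2 := by
    rw [div_pow, mul_pow, Real.sq_sqrt hNpos.le]; field_simp
  rw [e2] at hb2
  have hb2' : V / (ε ^ 2 / c ^ 2) < η / 2 := by
    rw [div_div_eq_mul_div]; exact hcV
  have hb1' : V / (N * δ ^ 2) < η / 2 := by
    have hlt : V / δ ^ 2 / (η / 2) < N := hN₀.trans (by exact_mod_cast hN)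
    rw [div_lt_iff₀ (by positivity), div_lt_iff₀ (by positivity)] at hlt
    rw [div_lt_iff₀ (by positivity)]
    linarith
  rw [Real.dist_eq, sub_zero, abs_of_nonneg measureReal_nonneg]
  refine lt_of_le_of_lt (measureReal_mono (s₂ := {ω | δ ≤ ‖W ω‖} ∪
    {ω | ε / (√(N : ℝ) * c) ≤ ‖W ω‖}) fun ω hω => ?_) ?_
  · simp only [Pi.zero_apply, sub_zero, Set.mem_ofPred_eq, norm_mul, Real.norm_eq_abs,
      abs_of_pos hsq] at hω
    simp only [Set.mem_union, Set.mem_ofPred_eq]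
    by_contra! hcon
    have hb := hball (y := fun e => (1 / (N : ℝ)) * ∑ n ∈ Finset.range N, Z n ω e)
      (by rw [dist_eq_norm]; exact hcon.1)
    have h3 := hcon.2
    rw [lt_div_iff₀ (by positivity)] at h3
    rw [Real.norm_eq_abs] at hb
    have := mul_le_mul_of_nonneg_left hb hsq.le
    have h4 : √(N : ℝ) * (c * ‖W ω‖) < ε := by linarith
    exact absurd (hω.trans this) (not_le.2 h4)
  · calc _ ≤ _ := measureReal_union_le _ _
      _ < η := by
        have := add_le_add hb1 hb2
        linarith

/-- **Delta method**: a function of the mean of i.i.d. square-integrable vectors, differentiable at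
the expectation, is asymptotically normal. -/
lemma tendstoInDistribution_sqrt_mul_mean_sub (P : Measure Ω) [IsProbabilityMeasure P]
    (Z : ℕ → Ω → ι → ℝ) (hL2 : ∀ n e, MemLp (fun ω => Z n ω e) 2 P)
    (hindep : iIndepFun Z P)
    (hident : ∀ n, IdentDistrib (Z n) (Z 0) P P) (m : ι → ℝ) (hm : ∀ e, m e = ∫ ω, Z 0 ω e ∂P)
    (f : (ι → ℝ) → ℝ) (hf : Measurable f) (D : (ι → ℝ) →L[ℝ] ℝ) (hD : HasFDerivAt f D m) :
    TendstoInDistribution (fun (N : ℕ) ω => √(N : ℝ) *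
      (f (fun e => (1 / (N : ℝ)) * ∑ n ∈ Finset.range N, Z n ω e) - f m)) atTop (id : ℝ → ℝ)
      (fun _ => P) (gaussianReal 0 Var[fun ω => D (Z 0 ω); P].toNNReal) := by
  obtain ⟨w, hw⟩ : ∃ w : ι → ℝ, ∀ z, D z = ∑ e, z e * w e := by
    classical
    refine ⟨fun e => D (Pi.single e 1), fun z => ?_⟩
    conv_lhs => rw [pi_eq_sum_univ' z]
    simp [map_sum]
  have hmemD : MemLp (fun ω => D (Z 0 ω)) 2 P := by
    simp_rw [hw]
    exact memLp_finsetSum _ fun e _ => (hL2 0 e).mul_const _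
  have hmeanD : ∫ ω, D (Z 0 ω) ∂P = D m := by
    simp_rw [hw, hm]
    rw [integral_finsetSum _ fun e _ => ((hL2 0 e).integrable (by norm_num)).mul_const _]
    simp_rw [integral_mul_const]
  -- The limit comes from the scalar variables D(Z n), so no multivariate central limit theorem is
  -- needed; Slutsky's lemma then absorbs the remainder.
  have hclt := tendstoInDistribution_inv_sqrt_mul_sum_sub (P := P)
    (P' := gaussianReal 0 Var[fun ω => D (Z 0 ω); P].toNNReal) (Y := id)
    (X := fun n ω => D (Z n ω)) HasLaw.id hmemD
    (hindep.comp (fun _ => D) fun _ => D.continuous.measurable)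
    (fun n => (hident n).comp (u := D) D.continuous.measurable)
  have hrem := tendstoInMeasure_sqrt_mul_mean_remainder P Z hL2 hindep hident m hm f D hD
  refine tendstoInDistribution_of_tendstoInMeasure_sub _ _ hclt ?_ ?_
  · refine hrem.congr' ?_ (Filter.EventuallyEq.refl _ _)
    filter_upwards [eventually_ne_atTop 0] with N hN
    refine Filter.Eventually.of_forall fun ω => ?_
    have hNpos : (0 : ℝ) < N := by positivity
    have e1 : (fun e => (1 / (N : ℝ)) * ∑ n ∈ Finset.range N, Z n ω e) =
        (1 / (N : ℝ)) • ∑ n ∈ Finset.range N, Z n ω := by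
      ext e; simp
    have e2 : (√(N : ℝ))⁻¹ * N = √(N : ℝ) := by
      rw [inv_mul_eq_div, Real.div_sqrt]
    have e3 : √(N : ℝ) * (1 / N) = (√(N : ℝ))⁻¹ := by
      rw [mul_one_div, Real.sqrt_div_self]
    simp only [Pi.sub_apply]
    rw [hmeanD, e1, map_sub, map_smul, map_sum, smul_eq_mul]
    linear_combination (-(∑ n ∈ Finset.range N, D (Z n ω))) * e3 - D m * e2
  · intro N
    refine (hf.comp_aemeasurable ?_).sub_const _ |>.const_mul _
    exact aemeasurable_pi_lambda _ fun e =>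
      (Finset.aemeasurable_fun_sum _ fun n _ => (hL2 n e).aemeasurable).const_mul _

end DeltaMethod

/-! ### The spectral likelihood as a function of the stacked moments -/

namespace Moments

variable {d : ℕ}

/-- The moments whose stacked vector of entries is `θ`. -/
def ofStack (θ : StackIdx d → ℝ) : Moments d where
  mu i := θ (.inl i)
  Sig := Matrix.of fun i j => θ (.inr (.inl (i, j)))
  K i j k := θ (.inr (.inr (i, j, k)))

lemma prodC_self (m : Moments d) (y : ℕ → Fin d → ℝ) (t : ℕ) : m.prodC y t t = 1 := by
  cases t <;> simp [prodC]

lemma prodC_succ (m : Moments d) (y : ℕ → Fin d → ℝ) {s t : ℕ} (h : s ≤ t) :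
    m.prodC y s (t + 1) = m.C (y (t + 1)) * m.prodC y s t := by
  simp [prodC, h]

lemma specLik_eq (m : Moments d) (T : ℕ) (y : ℕ → Fin d → ℝ) :
    m.specLik T y = m.mu ⬝ᵥ ((m.Sig⁻¹ * m.prodC y 0 T) *ᵥ m.mu) := by
  simp only [specLik, cInf, c1]
  rw [← Matrix.dotProduct_mulVec, Matrix.mulVec_mulVec]

section Measurability

lemma measurable_mul_apply {α : Type*} [MeasurableSpace α] {A B : α → Matrix (Fin d) (Fin d) ℝ}
    (hA : ∀ i j, Measurable fun θ => A θ i j) (hB : ∀ i j, Measurable fun θ => B θ i j)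
    (i j : Fin d) : Measurable fun θ => (A θ * B θ) i j := by
  simp only [Matrix.mul_apply]
  exact Finset.measurable_fun_sum _ fun k _ => (hA i k).mul (hB k j)

lemma measurable_ofStack_Sig_inv (i j : Fin d) :
    Measurable fun θ : StackIdx d → ℝ => (ofStack θ).Sig⁻¹ i j := by
  have hc : Continuous fun θ : StackIdx d → ℝ => (ofStack θ).Sig :=
    continuous_matrix fun i j => continuous_apply (Sum.inr (Sum.inl (i, j)) : StackIdx d)
  -- The inverse is det⁻¹ times the adjugate, with 0⁻¹ = 0. This is measurable on all matrices, and
  -- it realises the convention that a singular matrix has inverse 0.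
  simp only [Matrix.inv_def, Ring.inverse_eq_inv', Matrix.smul_apply, smul_eq_mul]
  exact hc.matrix_det.measurable.inv.mul (hc.matrix_adjugate.matrix_elem i j).measurable

lemma measurable_ofStack_Kmat (a : Fin d → ℝ) (i j : Fin d) :
    Measurable fun θ : StackIdx d → ℝ => (ofStack θ).Kmat a i j := by
  simp only [Kmat, Matrix.of_apply, ofStack]
  fun_prop

lemma measurable_ofStack_prodC (y : ℕ → Fin d → ℝ) (t : ℕ) (i j : Fin d) :
    Measurable fun θ : StackIdx d → ℝ => (ofStack θ).prodC y 0 t i j := by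
  induction t generalizing i j with
  | zero => simp only [prodC]; exact measurable_const
  | succ t ih =>
    simp only [prodC_succ _ _ (Nat.zero_le t), C]
    exact measurable_mul_apply
      (measurable_mul_apply (measurable_ofStack_Kmat _) measurable_ofStack_Sig_inv) ih i j

lemma measurable_specLik_ofStack (T : ℕ) (y : ℕ → Fin d → ℝ) :
    Measurable fun θ : StackIdx d → ℝ => (ofStack θ).specLik T y := by
  simp only [specLik_eq, dotProduct, Matrix.mulVec]
  have h := measurable_mul_apply (measurable_ofStack_Sig_inv (d := d)) (measurable_ofStack_prodC y T)
  have hmu : ∀ i : Fin d, Measurable fun θ : StackIdx d → ℝ => (ofStack θ).mu i := fun i =>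
    measurable_pi_apply (Sum.inl i : StackIdx d)
  exact Finset.measurable_fun_sum _ fun i _ => (hmu i).mul
    (Finset.measurable_fun_sum _ fun j _ => (h i j).mul (hmu j))

end Measurability

lemma dotProduct_mulVec_eq_sum_flat2 (u w : Fin d → ℝ) (A : Matrix (Fin d) (Fin d) ℝ) :
    u ⬝ᵥ (A *ᵥ w) = ∑ e : Fin d × Fin d, A e.1 e.2 * flat2 u w e := by
  rw [Fintype.sum_prod_type]
  simp only [dotProduct, Matrix.mulVec, flat2, Finset.mul_sum]
  exact Finset.sum_congr rfl fun i _ => Finset.sum_congr rfl fun j _ => by ring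

lemma dotProduct_Kmat_mulVec_eq_sum_flat3 (m : Moments d) (u w z : Fin d → ℝ) :
    u ⬝ᵥ (m.Kmat z *ᵥ w) =
      ∑ e : Fin d × Fin d × Fin d, m.K e.1 e.2.1 e.2.2 * flat3 u w z e := by
  rw [Fintype.sum_prod_type]
  simp only [Fintype.sum_prod_type, dotProduct, Matrix.mulVec, flat3, Finset.mul_sum, Kmat,
    Matrix.of_apply, Finset.sum_mul]
  exact Finset.sum_congr rfl fun i _ => Finset.sum_congr rfl fun j _ =>
    Finset.sum_congr rfl fun k _ => by ring

lemma dotProduct_mulVec_eq_b_bTilde (m : Moments d) (T : ℕ) (y : ℕ → Fin d → ℝ) (t : ℕ)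
    (X : Matrix (Fin d) (Fin d) ℝ) :
    m.mu ⬝ᵥ ((m.Sig⁻¹ * m.prodC y t T * X * (m.Sig⁻¹ * m.prodC y 0 t)) *ᵥ m.mu) =
      m.b T y t ⬝ᵥ (X *ᵥ m.bTilde y t) := by
  simp only [b, bTilde, Matrix.dotProduct_mulVec, Matrix.vecMul_vecMul, Matrix.mul_assoc]

lemma dotProduct_mulVec_eq_a_aTilde (m : Moments d) (T : ℕ) (y : ℕ → Fin d → ℝ) (t : ℕ)
    (X : Matrix (Fin d) (Fin d) ℝ) :
    m.mu ⬝ᵥ ((m.Sig⁻¹ * m.prodC y t T * X * (m.Sig⁻¹ * m.prodC y 0 (t - 1))) *ᵥ m.mu) =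
      m.a T y t ⬝ᵥ (X *ᵥ m.aTilde y t) := by
  simp only [a, aTilde, Matrix.dotProduct_mulVec, Matrix.vecMul_vecMul, Matrix.mul_assoc]

/-- Pairing a perturbation X with a flattened outer product u ⊗ w is the bilinear form uᵀXw, and
likewise for tensors. This puts ⟨β, h⟩ in the shape that the product rule produces. -/
lemma sum_betaVec_mul (m : Moments d) (T : ℕ) (y : ℕ → Fin d → ℝ) (h : StackIdx d → ℝ) :
    ∑ e, betaVec m T y e * h e =
      (ofStack h).mu ⬝ᵥ (m.vTilde T y) + m.v T y ⬝ᵥ (ofStack h).mu +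
      m.mu ⬝ᵥ ((-∑ t ∈ Finset.Icc 0 T, m.Sig⁻¹ * m.prodC y t T * (ofStack h).Sig *
          (m.Sig⁻¹ * m.prodC y 0 t) +
        ∑ t ∈ Finset.Icc 1 T, m.Sig⁻¹ * m.prodC y t T *
          (ofStack h).Kmat (y t) * (m.Sig⁻¹ * m.prodC y 0 (t - 1))) *ᵥ m.mu) := by
  rw [Matrix.add_mulVec, Matrix.neg_mulVec, Matrix.sum_mulVec, Matrix.sum_mulVec, dotProduct_add,
    dotProduct_neg, dotProduct_sum, dotProduct_sum]
  simp only [dotProduct_mulVec_eq_b_bTilde, dotProduct_mulVec_eq_a_aTilde]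
  simp only [dotProduct_Kmat_mulVec_eq_sum_flat3]
  simp only [dotProduct_mulVec_eq_sum_flat2]
  rw [Fintype.sum_sum_type, Fintype.sum_sum_type]
  simp only [betaVec, Sum.elim_inl, Sum.elim_inr, Pi.add_apply, Pi.neg_apply, Finset.sum_apply,
    neg_mul, Finset.sum_neg_distrib, Finset.sum_mul]
  rw [Finset.sum_comm (s := Finset.Icc 0 T), Finset.sum_comm (s := Finset.Icc 1 T)]
  have e1 : ∑ i, (m.v T y i + m.vTilde T y i) * h (Sum.inl i) =
      (ofStack h).mu ⬝ᵥ (m.vTilde T y) + m.v T y ⬝ᵥ (ofStack h).mu := by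
    simp only [dotProduct, ← Finset.sum_add_distrib]
    exact Finset.sum_congr rfl fun i _ => by simp only [ofStack]; ring
  rw [e1]
  simp only [ofStack, Matrix.of_apply, mul_comm]

section Derivative

-- The norm is auxiliary: it makes matrices a normed algebra, so that ring inversion has its
-- standard derivative. The resulting scalar derivative does not involve it.
attribute [local instance] Matrix.linftyOpNormedAddCommGroup Matrix.linftyOpNormedSpace
  Matrix.linftyOpNormedRing Matrix.linftyOpNormedAlgebra

/-- `Sig` of the stacked moments as a continuous linear map. -/
def sigCLM (d : ℕ) : (StackIdx d → ℝ) →L[ℝ] Matrix (Fin d) (Fin d) ℝ :=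
  LinearMap.toContinuousLinearMap
    { toFun := fun θ => (ofStack θ).Sig
      map_add' := fun _ _ => rfl
      map_smul' := fun _ _ => rfl }

/-- `Kmat a` of the stacked moments as a continuous linear map. -/
def kmatCLM (a : Fin d → ℝ) : (StackIdx d → ℝ) →L[ℝ] Matrix (Fin d) (Fin d) ℝ :=
  LinearMap.toContinuousLinearMap
    { toFun := fun θ => (ofStack θ).Kmat a
      map_add' := fun θ η => by
        ext i j; simp [Kmat, ofStack, add_mul, Finset.sum_add_distrib]
      map_smul' := fun c θ => by
        ext i j; simp [Kmat, ofStack, mul_assoc, Finset.mul_sum] }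

@[simp] lemma kmatCLM_apply (a : Fin d → ℝ) (θ : StackIdx d → ℝ) :
    kmatCLM a θ = (ofStack θ).Kmat a := rfl

lemma hasFDerivAt_ofStack_Sig_inv {θ : StackIdx d → ℝ} (hθ : IsUnit (ofStack θ).Sig) :
    ∃ D : (StackIdx d → ℝ) →L[ℝ] Matrix (Fin d) (Fin d) ℝ,
      HasFDerivAt (fun η : StackIdx d → ℝ => (ofStack η).Sig⁻¹) D θ ∧
      ∀ h, D h = -((ofStack θ).Sig⁻¹ * (ofStack h).Sig * (ofStack θ).Sig⁻¹) := by
  obtain ⟨u, hu⟩ := hθ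
  have h1 := hasFDerivAt_ringInverse (𝕜 := ℝ) u
  rw [hu] at h1
  have h2 := HasFDerivAt.comp (𝕜 := ℝ) θ h1 (sigCLM d).hasFDerivAt
  refine ⟨_, h2.congr_of_eventuallyEq (Filter.Eventually.of_forall fun η => ?_), fun h => ?_⟩
  · exact Matrix.nonsing_inv_eq_ringInverse _
  · rw [← hu, ← Matrix.coe_units_inv]
    rfl

/-- Induction on T for P_T = Σ⁻¹K(y_T)Σ⁻¹⋯K(y_1)Σ⁻¹, using P_{T+1} = Σ⁻¹K(y_{T+1})P_T and the
product rule. -/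
lemma hasFDerivAt_ofStack_Sig_inv_mul_prodC {θ : StackIdx d → ℝ} (hθ : IsUnit (ofStack θ).Sig)
    (y : ℕ → Fin d → ℝ) (T : ℕ) :
    ∃ D : (StackIdx d → ℝ) →L[ℝ] Matrix (Fin d) (Fin d) ℝ,
      HasFDerivAt (fun η : StackIdx d → ℝ => (ofStack η).Sig⁻¹ * (ofStack η).prodC y 0 T) D θ ∧
      ∀ h, D h =
        -∑ t ∈ Finset.Icc 0 T, (ofStack θ).Sig⁻¹ * (ofStack θ).prodC y t T * (ofStack h).Sig *
          ((ofStack θ).Sig⁻¹ * (ofStack θ).prodC y 0 t) +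
        ∑ t ∈ Finset.Icc 1 T, (ofStack θ).Sig⁻¹ * (ofStack θ).prodC y t T *
          (ofStack h).Kmat (y t) * ((ofStack θ).Sig⁻¹ * (ofStack θ).prodC y 0 (t - 1)) := by
  obtain ⟨I, hI, hI'⟩ := hasFDerivAt_ofStack_Sig_inv hθ
  induction T with
  | zero => exact ⟨I, by simpa [prodC] using hI, fun h => by simp [hI', prodC]⟩
  | succ T ih =>
    obtain ⟨D, hD, hD'⟩ := ih
    have hK := (kmatCLM (y (T + 1))).hasFDerivAt (x := θ)
    have h := hI.mul' (hK.mul' hD)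
    refine ⟨_, h.congr_of_eventuallyEq (Filter.Eventually.of_forall fun η => ?_), fun h => ?_⟩
    · simp only [prodC_succ _ _ (Nat.zero_le T), C, kmatCLM_apply, Pi.mul_apply, Matrix.mul_assoc]
    -- The old terms t ≤ T only acquire Σ⁻¹K(y_{T+1}) on the left. The new index t = T+1 in the two
    -- sums accounts for differentiating the new Σ⁻¹ and the new K.
    · have key : ∀ t ≤ T, (ofStack θ).Sig⁻¹ * (ofStack θ).prodC y t (T + 1) =
          (ofStack θ).Sig⁻¹ * (ofStack θ).Kmat (y (T + 1)) *
            ((ofStack θ).Sig⁻¹ * (ofStack θ).prodC y t T) := fun t ht => by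
        simp only [prodC_succ _ _ ht, C, Matrix.mul_assoc]
      rw [← Finset.insert_Icc_right_eq_Icc_add_one (by omega : 0 ≤ T + 1),
        ← Finset.insert_Icc_right_eq_Icc_add_one (by omega : 1 ≤ T + 1),
        Finset.sum_insert (by simp), Finset.sum_insert (by simp),
        Finset.sum_congr rfl (fun t ht => by rw [key t (Finset.mem_Icc.1 ht).2]),
        Finset.sum_congr (s₁ := Finset.Icc 1 T) rfl
          (fun t ht => by rw [key t (Finset.mem_Icc.1 ht).2])]
      change (ofStack θ).Sig⁻¹ * ((ofStack θ).Kmat (y (T + 1)) * D h + (ofStack h).Kmat (y (T + 1)) *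
        ((ofStack θ).Sig⁻¹ * (ofStack θ).prodC y 0 T)) + I h * ((ofStack θ).Kmat (y (T + 1)) *
        ((ofStack θ).Sig⁻¹ * (ofStack θ).prodC y 0 T)) = _
      rw [hI', hD', prodC_self, key 0 (Nat.zero_le T), Nat.add_sub_cancel]
      simp only [mul_add, mul_neg, Finset.mul_sum, neg_add_rev, mul_one, neg_mul, mul_assoc]
      abel

/-- The gradient of the spectral likelihood is `betaVec`. -/
lemma hasFDerivAt_specLik_ofStack {θ : StackIdx d → ℝ} (hθ : IsUnit (ofStack θ).Sig)
    (T : ℕ) (y : ℕ → Fin d → ℝ) :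
    ∃ D : (StackIdx d → ℝ) →L[ℝ] ℝ,
      HasFDerivAt (fun η : StackIdx d → ℝ => (ofStack η).specLik T y) D θ ∧
      ∀ h, D h = ∑ e, betaVec (ofStack θ) T y e * h e := by
  obtain ⟨G, hG, hG'⟩ := hasFDerivAt_ofStack_Sig_inv_mul_prodC hθ y T
  have hmu : ∀ i : Fin d, HasFDerivAt (fun η : StackIdx d → ℝ => (ofStack η).mu i)
      (ContinuousLinearMap.proj (R := ℝ) (φ := fun _ : StackIdx d => ℝ) (Sum.inl i)) θ := fun i =>
    (ContinuousLinearMap.proj (R := ℝ) (φ := fun _ : StackIdx d => ℝ) (Sum.inl i)).hasFDerivAt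
  let ev : Fin d → Fin d → Matrix (Fin d) (Fin d) ℝ →L[ℝ] ℝ := fun i j =>
    LinearMap.toContinuousLinearMap (Matrix.entryLinearMap ℝ ℝ i j)
  have hent : ∀ i j, HasFDerivAt (fun η : StackIdx d → ℝ =>
      ((ofStack η).Sig⁻¹ * (ofStack η).prodC y 0 T) i j) ((ev i j).comp G) θ := fun i j =>
    (ev i j).hasFDerivAt.comp θ hG
  have hsum := HasFDerivAt.fun_sum (u := Finset.univ) fun i _ => (hmu i).mul
    (HasFDerivAt.fun_sum (u := Finset.univ) fun j _ => (hent i j).mul (hmu j))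
  refine ⟨_, hsum.congr_of_eventuallyEq (Filter.Eventually.of_forall fun η => ?_), fun h => ?_⟩
  · simp only [specLik_eq, dotProduct, Matrix.mulVec, Pi.mul_apply]
  · rw [sum_betaVec_mul, ← hG']
    have hv : (ofStack h).mu ⬝ᵥ (ofStack θ).vTilde T y = ∑ i, (ofStack h).mu i *
        ∑ j, ((ofStack θ).Sig⁻¹ * (ofStack θ).prodC y 0 T) i j * (ofStack θ).mu j := rfl
    have hw : (ofStack θ).v T y ⬝ᵥ (ofStack h).mu = ∑ i, (ofStack θ).mu i *
        ∑ j, ((ofStack θ).Sig⁻¹ * (ofStack θ).prodC y 0 T) i j * (ofStack h).mu j := by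
      rw [v, ← Matrix.dotProduct_mulVec]; rfl
    have hev : (ofStack θ).mu ⬝ᵥ (G h *ᵥ (ofStack θ).mu) = ∑ i, (ofStack θ).mu i *
        ∑ j, ev i j (G h) * (ofStack θ).mu j := rfl
    rw [hv, hw, hev]
    simp only [_root_.sum_apply, _root_.add_apply,
      _root_.smul_apply, ContinuousLinearMap.proj_apply, smul_eq_mul,
      ContinuousLinearMap.comp_apply, Pi.mul_apply, Finset.sum_add_distrib, mul_add]
    have hm : ∀ i, h (Sum.inl i) = (ofStack h).mu i := fun _ => rfl
    simp only [hm, mul_comm]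
    ring

end Derivative
end Moments

/-! ### Asymptotic normality of the empirical spectral likelihood -/

lemma measurable_stack {d : ℕ} : Measurable (stack : (Fin 3 → Fin d → ℝ) → StackIdx d → ℝ) := by
  refine measurable_pi_lambda _ fun e => ?_
  rcases e with i | e | e <;> simp only [stack, Sum.elim_inl, Sum.elim_inr, flat2, flat3] <;>
    fun_prop

/-- Bilinearity of covariance; besides identifying the limit variance, it shows that the quadratic
form is nonnegative. -/
lemma asympVar_eq_variance {d : ℕ} (Q : Measure (Fin 3 → Fin d → ℝ)) [IsFiniteMeasure Q]
    (hmom : ∀ e : StackIdx d, MemLp (fun y => stack y e) 2 Q) (T : ℕ) (y : ℕ → Fin d → ℝ) :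
    asympVar Q T y = Var[fun z => ∑ e, betaVec (popMoments Q) T y e * stack z e; Q] := by
  rw [variance_fun_sum fun e => (hmom e).const_mul _]
  simp only [asympVar, dotProduct, Matrix.mulVec, stackCov, Matrix.of_apply, Finset.mul_sum,
    covariance_const_mul_left, covariance_const_mul_right]
  exact Finset.sum_congr rfl fun i _ => Finset.sum_congr rfl fun j _ => by ring

lemma tendstoInDistribution_specLik {d : ℕ} (Q : Measure (Fin 3 → Fin d → ℝ))
    [IsProbabilityMeasure Q]
    (hmom : ∀ e : StackIdx d, MemLp (fun y => stack y e) 2 Q)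
    (hSig : IsUnit (popMoments Q).Sig)
    {Ω : Type*} [MeasurableSpace Ω] (P : Measure Ω) [IsProbabilityMeasure P]
    (Y : ℕ → Ω → Fin 3 → Fin d → ℝ) (hlaw : ∀ n, HasLaw (Y n) Q P) (hindep : iIndepFun Y P)
    (T : ℕ) (y : ℕ → Fin d → ℝ) :
    TendstoInDistribution
      (fun (N : ℕ) (ω : Ω) => √(N : ℝ) *
        ((empMoments (fun n => Y n ω) N).specLik T y - (popMoments Q).specLik T y))
      atTop (id : ℝ → ℝ) (fun _ => P) (gaussianReal 0 (asympVar Q T y).toNNReal) := by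
  set θ : StackIdx d → ℝ := fun e => ∫ z, stack z e ∂Q
  obtain ⟨D, hD, hDβ⟩ := Moments.hasFDerivAt_specLik_ofStack (θ := θ) hSig T y
  have hmeas : ∀ e : StackIdx d, Measurable fun z : Fin 3 → Fin d → ℝ => stack z e := fun e =>
    measurable_stack.eval
  have hvar : Var[fun ω => D (stack (Y 0 ω)); P] = asympVar Q T y := by
    rw [asympVar_eq_variance Q hmom]
    rw [← (hlaw 0).map_eq, variance_map (by rw [(hlaw 0).map_eq]; exact
      (Finset.measurable_fun_sum _ fun e _ => (hmeas e).const_mul _).aemeasurable)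
      (hlaw 0).aemeasurable, (hlaw 0).map_eq]
    simp only [hDβ]
    rfl
  rw [← hvar]
  -- By definition, `ofStack` of the sample mean is `empMoments` and `ofStack θ` is `popMoments Q`.
  refine tendstoInDistribution_sqrt_mul_mean_sub P (fun n ω => stack (Y n ω)) ?_
    (hindep.comp (fun _ => stack) fun _ => measurable_stack)
    (fun n => ((hlaw n).identDistrib (hlaw 0)).comp measurable_stack) θ ?_
    (fun η => (Moments.ofStack η).specLik T y) (Moments.measurable_specLik_ofStack T y) D hD
  · intro n e
    have := hmom e
    rw [← (hlaw n).map_eq] at this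
    exact this.comp_of_map (hlaw n).aemeasurable
  · intro e
    exact ((hlaw 0).integral_comp (f := fun z => stack z e) (hmeas e).aestronglyMeasurable).symm

/-! ### The forward algorithm and the law of the observations -/

namespace HMM

variable {S p : ℕ}

/-- Forward recursion with weights `q t s` for state `s` at time `t`, starting at time `0`. -/
def forward (H : HMM S p) (q : ℕ → Fin S → ℝ) : ℕ → Fin S → ℝ
  | 0 => H.init
  | t + 1 => H.transᵀ *ᵥ (q t * forward H q t)

lemma sum_trans_transpose_mulVec (H : HMM S p) (w : Fin S → ℝ) :
    ∑ s, (H.transᵀ *ᵥ w) s = ∑ s, w s := by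
  simp only [Matrix.mulVec, dotProduct, Matrix.transpose_apply]
  rw [Finset.sum_comm]
  simp [← Finset.sum_mul, H.trans_sum]

lemma pathProb_snoc (H : HMM S p) (n : ℕ) (h : Fin (n + 1) → Fin S) (s : Fin S) :
    H.pathProb (n + 2) (Fin.snoc h s : Fin (n + 2) → Fin S) =
      H.pathProb (n + 1) h * H.trans (h (Fin.last n)) s := by
  simp only [pathProb]
  rw [Fin.prod_univ_castSucc, ← mul_assoc]
  congr 1
  · congr 1
    refine Finset.prod_congr rfl fun t _ => ?_
    rw [Fin.snoc_castSucc, Fin.succ_castSucc, Fin.snoc_castSucc]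
  · rw [Fin.snoc_castSucc, Fin.succ_last, Fin.snoc_last]

/-- Entry s of the forward vector sums over paths ending in s. In the induction the last transition
is moved onto the test function g. -/
lemma sum_forward_mul (H : HMM S p) (q : ℕ → Fin S → ℝ) (t : ℕ) (g : Fin S → ℝ) :
    ∑ s, H.forward q t s * g s = ∑ h : Fin (t + 1) → Fin S, H.pathProb (t + 1) h *
      ((∏ i : Fin t, q i (h i.castSucc)) * g (h (Fin.last t))) := by
  induction t generalizing g with
  | zero =>
    rw [← (Equiv.funUnique (Fin 1) (Fin S)).symm.sum_comp]
    simp [forward, pathProb]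
  | succ t ih =>
    have h1 : ∑ s, H.forward q (t + 1) s * g s =
        ∑ s, H.forward q t s * (q t s * ∑ s', H.trans s s' * g s') := by
      simp only [forward, Matrix.mulVec, dotProduct, Matrix.transpose_apply, Pi.mul_apply,
        Finset.sum_mul, Finset.mul_sum]
      rw [Finset.sum_comm]
      exact Finset.sum_congr rfl fun i _ => Finset.sum_congr rfl fun j _ => by ring
    rw [h1, ih, ← (Fin.snocEquiv fun _ : Fin (t + 2) => Fin S).sum_comp, Fintype.sum_prod_type,
      Finset.sum_comm]
    refine Finset.sum_congr rfl fun h _ => ?_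
    rw [Finset.mul_sum, Finset.mul_sum, Finset.mul_sum]
    refine Finset.sum_congr rfl fun s _ => ?_
    simp only [Fin.snocEquiv, Equiv.coe_fn_mk]
    rw [pathProb_snoc, Fin.prod_univ_castSucc]
    simp only [Fin.snoc_castSucc, Fin.snoc_last, Fin.val_castSucc, Fin.val_last]
    ring

/-- After n steps the forward vector already includes the transition to state n+1; since transitions
preserve total mass, that extra state sums out. -/
lemma sum_forward (H : HMM S p) (q : ℕ → Fin S → ℝ) (n : ℕ) :
    ∑ s, H.forward q n s = ∑ h : Fin n → Fin S, H.pathProb n h * ∏ i : Fin n, q i (h i) := by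
  cases n with
  | zero => simp [forward, pathProb, H.init_sum]
  | succ n =>
    have h := H.sum_forward_mul q n (q n)
    rw [forward, sum_trans_transpose_mulVec]
    simp only [Pi.mul_apply, mul_comm (q n _)]
    rw [h]
    exact Finset.sum_congr rfl fun h _ => by rw [Fin.prod_univ_castSucc]; rfl

lemma pathProb_nonneg (H : HMM S p) (n : ℕ) (h : Fin n → Fin S) : 0 ≤ H.pathProb n h := by
  cases n with
  | zero => simp [pathProb]
  | succ n => exact mul_nonneg (H.init_nonneg _) (Finset.prod_nonneg fun _ _ => H.trans_nonneg _ _)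

/-- Given the hidden path, the observations are independent, so the integral of the product factors
and the path sum is a forward recursion. -/
lemma integral_obsLaw_prod (H : HMM S p) (n : ℕ) (f : ℕ → (Fin p → ℝ) → ℝ)
    (hf : ∀ t s, Integrable (f t) (H.emission s)) :
    ∫ X, ∏ t : Fin n, f t (X t) ∂H.obsLaw n =
      ∑ s, H.forward (fun t s => ∫ z, f t z ∂H.emission s) n s := by
  have := H.emission_prob
  rw [sum_forward, obsLaw, integral_finsetSum_measure]
  · refine Finset.sum_congr rfl fun h _ => ?_
    rw [integral_smul_measure, ENNReal.toReal_ofReal (H.pathProb_nonneg n h), smul_eq_mul,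
      integral_fintype_prod_eq_prod (μ := fun t => H.emission (h t)) (fun (t : Fin n) => f t)]
  · intro h _
    refine Integrable.smul_measure ?_ ENNReal.ofReal_ne_top
    exact Integrable.fintype_prod (μ := fun t => H.emission (h t)) (f := fun (t : Fin n) => f t)
      fun t => hf t (h t)

end HMM

/-! ### Moments of a discrete hidden Markov model and its spectral likelihood -/

section UnitVectors

variable {p : ℕ} {ν : Measure (Fin p → ℝ)} [IsProbabilityMeasure ν]

lemma finite_unitVectors (p : ℕ) : (unitVectors p).Finite := Set.finite_range _

lemma ae_mem_unitVectors (hν : ν (unitVectors p) = 1) : ∀ᵐ z ∂ν, z ∈ unitVectors p :=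
  (mem_ae_iff_prob_eq_one (finite_unitVectors p).measurableSet).2 hν

lemma integrable_of_unitVectors (hν : ν (unitVectors p) = 1) {f : (Fin p → ℝ) → ℝ}
    (hf : Measurable f) : Integrable f ν := by
  refine Integrable.of_bound hf.aestronglyMeasurable (∑ o : Fin p, ‖f (Pi.single o 1)‖) ?_
  filter_upwards [ae_mem_unitVectors hν] with z hz
  obtain ⟨o, rfl⟩ := hz
  exact Finset.single_le_sum (f := fun o : Fin p => ‖f (Pi.single o 1)‖)
    (fun _ _ => norm_nonneg _) (Finset.mem_univ o)

/-- On unit vectors, being the symbol o is the same as having o-th coordinate 1; hence emission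
probabilities are entries of the mean matrix. -/
lemma integral_indicator_single (hν : ν (unitVectors p) = 1) (o : Fin p) :
    ∫ z, ({Pi.single o 1} : Set (Fin p → ℝ)).indicator 1 z ∂ν = ∫ z, z o ∂ν := by
  refine integral_congr_ae ?_
  filter_upwards [ae_mem_unitVectors hν] with z hz
  obtain ⟨o', rfl⟩ := hz
  by_cases h : o = o'
  · subst h; simp
  · have : (Pi.single o' 1 : Fin p → ℝ) ≠ Pi.single o 1 := fun hc => by
      have := congrFun hc o
      simp [Pi.single_eq_of_ne h] at this
    simp [this, Pi.single_eq_of_ne h]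

end UnitVectors

namespace HMM

section Moments

variable {S p d : ℕ}

lemma integral_obsLaw_three (H : HMM S p) (f₀ f₁ f₂ : (Fin p → ℝ) → ℝ)
    (h₀ : ∀ s, Integrable f₀ (H.emission s)) (h₁ : ∀ s, Integrable f₁ (H.emission s))
    (h₂ : ∀ s, Integrable f₂ (H.emission s)) :
    ∫ X, f₀ (X 0) * f₁ (X 1) * f₂ (X 2) ∂H.obsLaw 3 =
      ∑ s, (∫ z, f₂ z ∂H.emission s) * (H.transᵀ *ᵥ ((fun s => ∫ z, f₁ z ∂H.emission s) *
        (H.transᵀ *ᵥ ((fun s => ∫ z, f₀ z ∂H.emission s) * H.init)))) s := by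
  have h := H.integral_obsLaw_prod 3
    (fun t => if t = 0 then f₀ else if t = 1 then f₁ else f₂) (fun t s => by
      split_ifs
      exacts [h₀ s, h₁ s, h₂ s])
  simp only [forward, sum_trans_transpose_mulVec] at h
  simpa [Fin.prod_univ_three] using h

lemma integral_transpose_mulVec (H : HMM S p) (U : Matrix (Fin p) (Fin d) ℝ)
    (hH : ∀ s, H.emission s (unitVectors p) = 1) (i : Fin d) (s : Fin S) :
    ∫ z, (Uᵀ *ᵥ z) i ∂H.emission s = (Uᵀ * H.meanMatrix) i s := by
  have := H.emission_prob
  simp only [Matrix.mulVec, dotProduct, Matrix.mul_apply, meanMatrix, Matrix.of_apply]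
  rw [integral_finsetSum _ fun o _ =>
    (integrable_of_unitVectors (hH s) (measurable_pi_apply o)).const_mul _]
  simp only [integral_const_mul]

lemma mul_diagonal_mul_transpose_apply (B : Matrix (Fin S) (Fin S) ℝ) (w : Fin S → ℝ)
    (A : Matrix (Fin d) (Fin S) ℝ) (s : Fin S) (j : Fin d) :
    (B * (Matrix.diagonal w * Aᵀ)) s j = (B *ᵥ (A.row j * w)) s := by
  rw [Matrix.mul_apply]
  refine Finset.sum_congr rfl fun s' _ => ?_
  rw [Matrix.diagonal_mul, Matrix.transpose_apply A, Pi.mul_apply, Matrix.row_apply,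
    mul_comm (w s')]

lemma integral_tripleLaw (H : HMM S p) (U : Matrix (Fin p) (Fin d) ℝ)
    {g : (Fin 3 → Fin d → ℝ) → ℝ} (hg : Measurable g) :
    ∫ y, g y ∂H.tripleLaw U = ∫ X, g (fun j => Uᵀ *ᵥ X j) ∂H.obsLaw 3 := by
  rw [tripleLaw, integral_map _ hg.aestronglyMeasurable]
  refine (Continuous.measurable ?_).aemeasurable
  exact continuous_pi fun j => Continuous.matrix_mulVec continuous_const (continuous_apply j)

section

variable (H : HMM S p) (U : Matrix (Fin p) (Fin d) ℝ)

lemma integrable_transpose_mulVec (hH : ∀ s, H.emission s (unitVectors p) = 1)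
    (i : Fin d) (s : Fin S) :
    Integrable (fun z => (Uᵀ *ᵥ z) i) (H.emission s) := by
  have := H.emission_prob
  refine integrable_of_unitVectors (hH s) (Continuous.measurable ?_)
  exact (continuous_apply i).comp (Continuous.matrix_mulVec continuous_const continuous_id)

lemma popMoments_mu (hH : ∀ s, H.emission s (unitVectors p) = 1) :
    (popMoments (H.tripleLaw U)).mu = (Uᵀ * H.meanMatrix) *ᵥ H.init := by
  have := H.emission_prob
  ext i
  have h := H.integral_obsLaw_three (fun z => (Uᵀ *ᵥ z) i) (fun _ => 1) (fun _ => 1)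
    (H.integrable_transpose_mulVec U hH i) (fun _ => integrable_const _)
    (fun _ => integrable_const _)
  simp only [popMoments]
  rw [H.integral_tripleLaw U (by fun_prop)]
  simp only [integral_const, probReal_univ, smul_eq_mul, mul_one, one_mul,
    integral_transpose_mulVec H U hH] at h
  rw [h, sum_trans_transpose_mulVec]
  have e : (fun _ : Fin S => (1 : ℝ)) = 1 := rfl
  rw [e, one_mul, sum_trans_transpose_mulVec]
  rfl

lemma popMoments_Sig (hH : ∀ s, H.emission s (unitVectors p) = 1) :
    (popMoments (H.tripleLaw U)).Sig = (Uᵀ * H.meanMatrix) *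
      (H.transᵀ * (Matrix.diagonal H.init * (Uᵀ * H.meanMatrix)ᵀ)) := by
  have := H.emission_prob
  ext i j
  have h := H.integral_obsLaw_three (fun z => (Uᵀ *ᵥ z) j) (fun z => (Uᵀ *ᵥ z) i) (fun _ => 1)
    (H.integrable_transpose_mulVec U hH j) (H.integrable_transpose_mulVec U hH i)
    (fun _ => integrable_const _)
  simp only [popMoments, Matrix.of_apply]
  rw [H.integral_tripleLaw U (by fun_prop)]
  simp only [integral_const, probReal_univ, smul_eq_mul, mul_one, one_mul,
    integral_transpose_mulVec H U hH] at h
  simp only [mul_comm ((Uᵀ *ᵥ _) i)]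
  rw [h, sum_trans_transpose_mulVec, Matrix.mul_apply]
  refine Finset.sum_congr rfl fun s _ => ?_
  rw [mul_diagonal_mul_transpose_apply]
  rfl

lemma popMoments_K (hH : ∀ s, H.emission s (unitVectors p) = 1)
    (i j k : Fin d) :
    (popMoments (H.tripleLaw U)).K i j k = ∑ s, (Uᵀ * H.meanMatrix) i s *
      (H.transᵀ *ᵥ ((Uᵀ * H.meanMatrix).row k *
        (H.transᵀ *ᵥ ((Uᵀ * H.meanMatrix).row j * H.init)))) s := by
  have h := H.integral_obsLaw_three (fun z => (Uᵀ *ᵥ z) j) (fun z => (Uᵀ *ᵥ z) k)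
    (fun z => (Uᵀ *ᵥ z) i)
    (H.integrable_transpose_mulVec U hH j) (H.integrable_transpose_mulVec U hH k)
    (H.integrable_transpose_mulVec U hH i)
  simp only [popMoments]
  rw [H.integral_tripleLaw U (by fun_prop)]
  simp only [integral_transpose_mulVec H U hH] at h
  refine Eq.trans ?_ h
  congr 1
  ext X
  ring

/-- K(a) has the same outer factors as Σ, with one extra emission weighting and transition between
them; these outer factors cancel in K(a)Σ⁻¹. -/
lemma popMoments_Kmat (hH : ∀ s, H.emission s (unitVectors p) = 1)
    (a : Fin d → ℝ) :
    (popMoments (H.tripleLaw U)).Kmat a = (Uᵀ * H.meanMatrix) *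
      (H.transᵀ * (Matrix.diagonal ((Uᵀ * H.meanMatrix)ᵀ *ᵥ a) *
      (H.transᵀ * (Matrix.diagonal H.init * (Uᵀ * H.meanMatrix)ᵀ)))) := by
  ext i j
  simp only [Moments.Kmat, Matrix.of_apply, popMoments_K H U hH]
  generalize Uᵀ * H.meanMatrix = A
  rw [Matrix.mul_apply]
  have hu : ∀ s, (H.transᵀ * (Matrix.diagonal (Aᵀ *ᵥ a) *
      (H.transᵀ * (Matrix.diagonal H.init * Aᵀ)))) s j =
      (H.transᵀ *ᵥ ((Aᵀ *ᵥ a) * (H.transᵀ *ᵥ (A.row j * H.init)))) s := fun s => by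
    rw [Matrix.mul_apply]
    refine Finset.sum_congr rfl fun s' _ => ?_
    rw [Matrix.diagonal_mul, mul_diagonal_mul_transpose_apply, Pi.mul_apply]
  refine Eq.trans ?_ (Finset.sum_congr rfl fun s _ => congrArg (A i s * ·) (hu s).symm)
  generalize H.transᵀ *ᵥ (A.row j * H.init) = u
  simp only [Finset.sum_mul]
  rw [Finset.sum_comm]
  refine Finset.sum_congr rfl fun s _ => ?_
  simp only [Matrix.mulVec, dotProduct, Pi.mul_apply, Finset.mul_sum, Finset.sum_mul,
    Matrix.transpose_apply, Matrix.row_apply]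
  rw [Finset.sum_comm]
  exact Finset.sum_congr rfl fun s' _ => Finset.sum_congr rfl fun k _ => by ring

end

end Moments

/-- With invertible `Σ`, the spectral likelihood is the total mass of the forward vector whose
weights are the coordinates of `y t` in the projected emission means. -/
lemma specLik_eq_sum_forward {S p : ℕ} (H : HMM S p) (U : Matrix (Fin p) (Fin S) ℝ)
    (hH : ∀ s, H.emission s (unitVectors p) = 1) (hSig : IsUnit (popMoments (H.tripleLaw U)).Sig)
    (T : ℕ) (y : ℕ → Fin S → ℝ) :
    (popMoments (H.tripleLaw U)).specLik T y =
      ∑ s, H.forward (fun t => (Uᵀ * H.meanMatrix)ᵀ *ᵥ y (t + 1)) T s := by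
  set m := popMoments (H.tripleLaw U)
  have hmu : m.mu = (Uᵀ * H.meanMatrix) *ᵥ H.init := H.popMoments_mu U hH
  have hS := H.popMoments_Sig U hH
  have hK := H.popMoments_Kmat U hH
  change m.Sig = _ at hS
  change ∀ a, m.Kmat a = _ at hK
  generalize Uᵀ * H.meanMatrix = A at *
  set B := H.transᵀ * (Matrix.diagonal H.init * Aᵀ) with hB
  -- Here d = S matters: A and B are square, so invertibility of Σ = AB passes to both.
  have hdet : IsUnit (A.det * B.det) := by
    rw [← Matrix.det_mul, ← hS]; exact (Matrix.isUnit_iff_isUnit_det _).1 hSig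
  have hA : IsUnit A.det := isUnit_of_mul_isUnit_left hdet
  have hBu : IsUnit B.det := isUnit_of_mul_isUnit_right hdet
  have hSd : IsUnit m.Sig.det := (Matrix.isUnit_iff_isUnit_det _).1 hSig
  have hC : ∀ a, m.C a * A = A * (H.transᵀ * Matrix.diagonal (Aᵀ *ᵥ a)) := fun a => by
    rw [Moments.C, hK, hS, Matrix.mul_inv_rev]
    simp only [Matrix.mul_assoc]
    rw [Matrix.nonsing_inv_mul _ hA, Matrix.mul_one, Matrix.mul_nonsing_inv _ hBu, Matrix.mul_one]
  have hprod : m.prodC y 0 T *ᵥ m.c1 =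
      A *ᵥ H.forward (fun t => Aᵀ *ᵥ y (t + 1)) T := by
    induction T with
    | zero => simp [Moments.prodC, Moments.c1, forward, hmu]
    | succ T ih =>
      rw [Moments.prodC_succ _ _ (Nat.zero_le T), ← Matrix.mulVec_mulVec, ih, Matrix.mulVec_mulVec,
        hC, forward, ← Matrix.mulVec_mulVec, ← Matrix.mulVec_mulVec]
      congr 2
      ext s
      rw [Matrix.mulVec_diagonal]
      rfl
  -- Multiply by Σ: 1ᵀA⁻¹Σ = 1ᵀ𝐓ᵀ diag(π)Aᵀ = πᵀAᵀ = μᵀ, because the rows of 𝐓 sum to 1.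
  have hinf : m.cInf = 1 ᵥ* A⁻¹ := by
    have h : (1 ᵥ* A⁻¹) ᵥ* m.Sig = m.mu := by
      rw [hS, Matrix.vecMul_vecMul, ← Matrix.mul_assoc, Matrix.nonsing_inv_mul _ hA,
        Matrix.one_mul, hB, ← Matrix.vecMul_vecMul, ← Matrix.vecMul_vecMul, Matrix.vecMul_transpose,
        Matrix.vecMul_transpose, hmu]
      congr 1
      ext s
      rw [Matrix.vecMul_diagonal]
      simp [Matrix.mulVec, dotProduct, H.trans_sum]
    rw [Moments.cInf, ← h, Matrix.vecMul_vecMul, Matrix.mul_nonsing_inv _ hSd, Matrix.vecMul_one]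
  rw [Moments.specLik, hprod, hinf, ← Matrix.dotProduct_mulVec, Matrix.mulVec_mulVec,
    Matrix.nonsing_inv_mul _ hA, Matrix.one_mulVec, one_dotProduct]

/-- The spectral likelihood of a discrete hidden Markov model is its likelihood. -/
lemma specLik_eq_obsLaw_real {S p : ℕ} (H : HMM S p) (U : Matrix (Fin p) (Fin S) ℝ)
    (hH : ∀ s, H.emission s (unitVectors p) = 1) (hSig : IsUnit (popMoments (H.tripleLaw U)).Sig)
    (hU : U * Uᵀ * H.meanMatrix = H.meanMatrix) (T : ℕ) (x : ℕ → Fin p → ℝ)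
    (hx : ∀ t ∈ Finset.Icc 1 T, x t ∈ unitVectors p) :
    (popMoments (H.tripleLaw U)).specLik T (fun t => Uᵀ *ᵥ x t) =
      (H.obsLaw T).real {fun t : Fin T => x ((t : ℕ) + 1)} := by
  have := H.emission_prob
  have hind : ∀ t, Measurable (({x (t + 1)} : Set (Fin p → ℝ)).indicator (1 : (Fin p → ℝ) → ℝ)) :=
    fun t => measurable_one.indicator (measurableSet_singleton _)
  have hreal : (H.obsLaw T).real {fun t : Fin T => x ((t : ℕ) + 1)} =
      ∫ X, ∏ t : Fin T, ({x (t + 1)} : Set (Fin p → ℝ)).indicator 1 (X t) ∂H.obsLaw T := by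
    rw [← integral_indicator_one (measurableSet_singleton _)]
    congr 1
    ext X
    simp only [Set.indicator_apply, Set.mem_singleton_iff, Pi.one_apply, Finset.prod_ite_zero,
      funext_iff, Finset.mem_univ, true_imp_iff, Finset.prod_const_one]
  rw [hreal, H.integral_obsLaw_prod T (fun t => ({x (t + 1)} : Set (Fin p → ℝ)).indicator 1)
    (fun t s => integrable_of_unitVectors (hH s) (hind t)),
    specLik_eq_sum_forward H U hH hSig, sum_forward, sum_forward]
  refine Finset.sum_congr rfl fun h _ => ?_
  congr 1
  refine Finset.prod_congr rfl fun t _ => ?_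
  obtain ⟨o, ho⟩ := hx (t + 1) (Finset.mem_Icc.2 ⟨by omega, by omega⟩)
  simp only [← ho, integral_indicator_single (hH _)]
  -- The forward weight is (UUᵀM)ᵀx = Mᵀx, which for x = e_o is row o of M.
  rw [Matrix.mulVec_mulVec, ← Matrix.transpose_mul, ← Matrix.mul_assoc, hU]
  simp [meanMatrix]

end HMM

theorem mainTheorem1 {S p d : ℕ} (H : HMM S p) (U : Matrix (Fin p) (Fin d) ℝ)
    (hmom : ∀ e : StackIdx d, MemLp (fun y => stack y e) 2 (H.tripleLaw U))
    (hSig : IsUnit (popMoments (H.tripleLaw U)).Sig)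
    {Ω : Type*} [MeasurableSpace Ω] (P : Measure Ω) [IsProbabilityMeasure P]
    (Y : ℕ → Ω → Fin 3 → Fin d → ℝ)
    (hlaw : ∀ n, HasLaw (Y n) (H.tripleLaw U) P)
    (hindep : iIndepFun Y P)
    (T : ℕ) (x : ℕ → Fin p → ℝ) :
    (∃ σ2 : ℝ≥0, (σ2 : ℝ) = asympVar (H.tripleLaw U) T (fun t => Uᵀ *ᵥ x t) ∧
      TendstoInDistribution
        (fun (N : ℕ) (ω : Ω) => √(N : ℝ) *
          ((empMoments (fun n => Y n ω) N).specLik T (fun t => Uᵀ *ᵥ x t) -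
            (popMoments (H.tripleLaw U)).specLik T (fun t => Uᵀ *ᵥ x t)))
        atTop (id : ℝ → ℝ) (fun _ => P) (gaussianReal 0 σ2)) ∧
    (S = d → (∀ s, H.emission s (unitVectors p) = 1) →
      U * Uᵀ * H.meanMatrix = H.meanMatrix →
      (∀ t ∈ Finset.Icc 1 T, x t ∈ unitVectors p) →
      (popMoments (H.tripleLaw U)).specLik T (fun t => Uᵀ *ᵥ x t) =
        (H.obsLaw T).real {fun t : Fin T => x ((t : ℕ) + 1)}) := by
  have hQ : IsProbabilityMeasure (H.tripleLaw U) := by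
    rw [← (hlaw 0).map_eq]
    exact Measure.isProbabilityMeasure_map (hlaw 0).aemeasurable
  refine ⟨⟨_, Real.coe_toNNReal _ ?_,
    tendstoInDistribution_specLik _ hmom hSig P Y hlaw hindep T _⟩, ?_⟩
  · rw [asympVar_eq_variance _ hmom]
    exact variance_nonneg _ _
  · rintro rfl hH hU hx
    exact H.specLik_eq_obsLaw_real U hH hSig hU T x hx
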